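/- **Setting.** Let $p\ge 1$ and let $1\le r_1\le r_2\le\dots\le r_p$ be integers with $r_d\mid r_{d+1}$ for $1\le d\le p-1$. Let $\alpha\ge 1$ be an integer and put $r_0=1$, $r_{p+1}=\alpha$. For $r\ge 1$, cut a binary string $x\in\{0,1\}^\beta$ ($\beta\ge1$) from the left into consecutive $r$-blocks, all of length $r$ except possibly the last, which has length between $1$ and $r$. For $0\le d\le p$ and $x,y\in\{0,1\}^\beta$ let $\eta_d(x,y)=0$ if $x=y$, and otherwise $\eta_d(x,y)=(i,\{x_i,y_i\})$, where $i$ is the least index at which the $r_d$-blocks $x_i$ of $x$ and $y_i$ of $y$ differ. For $x,y\in\{0,1\}^\alpha$ and $0\le d\le p$, let $\xi_d(x,y)$ be the tuple of the values of $\eta_d$ at the corresponding $r_{d+1}$-blocks of $x$ and $y$. The CFLS coloring gives the edge between distinct $x,y\in\{0,1\}^\alpha$ the color $$c_p(x,y)=\bigl(\xi_p(x,y),\xi_{p-1}(x,y),\dots,\xi_0(x,y)\bigr).$$ **Definitions.** Let $f$ be an edge-coloring of a complete graph. For a finite set $S$ of vertices, $f(S)$ denotes the set of colors of the edges with both ends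 in $S$. - $S$ has a *leftover structure under $f$* if $|S|=1$, or if $S$ is the disjoint union of nonempty sets $A$ and $B$ such that $A$ and $B$ each have a leftover structure under $f$, $f(A)\cap f(B)=\emptyset$, and there is a color $\gamma\notin f(A)\cup f(B)$ with $f(ab)=\gamma$ for all $a\in A$, $b\in B$. - $S$ *contains a striped $K_4$ under $f$* if there are four distinct vertices $a,b,c,d\in S$ with $f(ab)=f(cd)$, $f(ac)=f(bd)$, $f(ad)=f(bc)$, where the three colors $f(ab),f(ac),f(ad)$ are pairwise distinct. **Lemma 2.1.** Let $S\subseteq\{0,1\}^\alpha$ be a set with $|S|\le p+3$ such that exactly $|S|-1$ distinct colors occur under $c_p$ on the edges with both ends in $S$. Then $S$ has a leftover structure under $c_p$ or contains a striped $K_4$ under $c_p$. -/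

import Mathlib

namespace CFLS

/-- Binary strings of length `α`, that is, the elements of `{0,1}^α`. -/
abbrev BinString (α : ℕ) : Type := List.Vector Bool α

/-- The set `f(S)` of colors that the edge-coloring `f` uses on pairs of distinct vertices
of `S`. An edge-coloring is written as a function of the two ends of the edge. -/
def colorSet {V C : Type*} (f : V → V → C) (S : Finset V) : Set C :=
  {γ | ∃ x ∈ S, ∃ y ∈ S, x ≠ y ∧ f x y = γ}

/-- `S` has a leftover structure under the edge-coloring `f`. -/
inductive HasLeftoverStructure {V C : Type*} [DecidableEq V] (f : V → V → C) : Finset V → Prop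
  | single (v : V) : HasLeftoverStructure f {v}
  | bipartition (A B : Finset V) (γ : C)
      (hA : A.Nonempty) (hB : B.Nonempty) (hAB : Disjoint A B)
      (leftA : HasLeftoverStructure f A) (leftB : HasLeftoverStructure f B)
      (hcolors : Disjoint (colorSet f A) (colorSet f B))
      (hcross : ∀ a ∈ A, ∀ b ∈ B, f a b = γ)
      (hγA : γ ∉ colorSet f A) (hγB : γ ∉ colorSet f B) :
      HasLeftoverStructure f (A ∪ B)

/-- `a, b, c, d` are the four (distinct) vertices of a striped `K_4` under `f`. -/
def IsStripedK4 {V C : Type*} (f : V → V → C) (a b c d : V) : Prop :=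
  (a ≠ b ∧ a ≠ c ∧ a ≠ d ∧ b ≠ c ∧ b ≠ d ∧ c ≠ d) ∧
  (f a b = f c d ∧ f a c = f b d ∧ f a d = f b c) ∧
  (f a b ≠ f a c ∧ f a b ≠ f a d ∧ f a c ≠ f a d)

/-- `S` contains a striped `K_4` under `f`. -/
def ContainsStripedK4 {V C : Type*} (f : V → V → C) (S : Finset V) : Prop :=
  ∃ a ∈ S, ∃ b ∈ S, ∃ c ∈ S, ∃ d ∈ S, IsStripedK4 f a b c d

/-- The `i`-th block, counted from `i = 0`, when `x` is cut from the left into consecutive blocks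
of length `r`, the last one possibly shorter. -/
def block (r i : ℕ) (x : List Bool) : List Bool :=
  (x.drop (i * r)).take r

/-- The number of blocks of length `r` of a string of length `β ≥ 1`: it is `a + 1`, where
`β = a * r + b` and `1 ≤ b ≤ r`, so that `a` is the rounded down quotient `(β - 1) / r`. -/
def numBlocks (r β : ℕ) : ℕ :=
  (β - 1) / r + 1

/-- The function `η` with block length `r`: for `x ≠ y` it is the pair of the least index `i` at
which the blocks of `x` and `y` differ and the unordered pair `{x_i, y_i}` of these two blocks;
the value `0` at `x = y` is written `none`. -/
noncomputable def eta (r : ℕ) (x y : List Bool) : Option (ℕ × Sym2 (List Bool)) :=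
  if x = y then none
  else
    let i := sInf {i : ℕ | block r i x ≠ block r i y}
    some (i, s(block r i x, block r i y))

/-- The sequence `r_0 = 1, r_1, …, r_p, r_{p+1} = α`; only `r 1, …, r p` are used from `r`. -/
def param (p : ℕ) (r : ℕ → ℕ) (α d : ℕ) : ℕ :=
  if d = 0 then 1 else if d ≤ p then r d else α

/-- `ξ_d(x, y)`: the tuple of the values of `η_d` at the corresponding `r_{d+1}`-blocks of
`x` and `y`. -/
noncomputable def xi (p : ℕ) (r : ℕ → ℕ) {α : ℕ} (d : ℕ) (x y : BinString α) :
    List (Option (ℕ × Sym2 (List Bool))) :=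
  (List.range (numBlocks (param p r α (d + 1)) α)).map fun i =>
    eta (param p r α d) (block (param p r α (d + 1)) i x.toList)
      (block (param p r α (d + 1)) i y.toList)

/-- The coloring `c_p` of pairs of strings in `{0,1}^α` with parameters `r_1, …, r_p`: the tuple
of all `ξ_d(x, y)`, `0 ≤ d ≤ p`, indexed by `d`. -/
noncomputable def cflsColor (p : ℕ) (r : ℕ → ℕ) {α : ℕ} (x y : BinString α) :
    Fin (p + 1) → List (Option (ℕ × Sym2 (List Bool))) :=
  fun d => xi p r (d : ℕ) x y

theorem eta_comm (r : ℕ) (x y : List Bool) : eta r x y = eta r y x := by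
  unfold eta
  by_cases h : x = y
  · simp [h]
  · have h2 : ¬ y = x := fun e => h e.symm
    simp only [if_neg h, if_neg h2, ne_comm (a := block r _ x), Sym2.eq_swap (a := block r _ x)]

/-- The value of `c_p` does not depend on the order of the two ends, so `c_p` is a coloring
of edges. -/
theorem cflsColor_comm (p : ℕ) (r : ℕ → ℕ) {α : ℕ} (x y : BinString α) :
    cflsColor p r x y = cflsColor p r y x := by
  funext d
  simp only [cflsColor, xi]
  congr 1
  funext i
  exact eta_comm _ _ _

end CFLS

/-!
Write a string as a prefix, made of full `r_p`-blocks, followed by its last `r_p`-block. A pair with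
distinct prefixes has a color that is determined by, and determines, the `c_p`-color of the prefixes
and the `c_{p-1}`-color of the last blocks; a pair with equal prefixes has a color that names its
two last blocks.

**At most `p + 3` strings have at least `|S| - 1` colors** (`productExpanding_recColor`). This is
the theorem of Conlon, Fox, Lee and Sudakov; it is proved by induction on `p` and on the length. If
no two elements of `S` have the same last block, or if `p = 0`, then colors inside fibers of the
prefix map determine the pair, so each further element of a fiber brings a new color. Otherwise
there are at most `p + 2` last blocks, and `c_p` refines the product of `c_p` on prefixes with
`c_{p-1}` on last blocks, to both of which induction applies. To make products harmless, the
inductive statement is not the bound itself but `ProductExpanding`: the product with *every*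
coloring that satisfies the bound on all subsets satisfies it as well. With the diagonal counted as
one more value the bound reads "at least `|T|` values on `T`", and the step for fibers
(`ProductExpanding.of_twin`) is inclusion-exclusion: identifying two twins with fibers `A`, `B`
loses `|A ∩ B|` elements, and at least as many values on `A ∩ B` are counted twice.

**Equality** (`leftover_or_striped_recColor`). If two different pairs inside fibers have the same
color, then their four ends form a striped `K_4`. If there are no such pairs, then a set with
`|S| - 1` colors arises from its set of prefixes by adding twins, each joined to its original by a
new color (`lift_of_tight`); the set of prefixes again has as few colors as possible, and both
leftover structures and striped copies of `K_4` lift from it to `S`.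
-/

namespace CFLS

/-! ### Expanding colorings and products -/

open Classical in
/-- All values of `φ` on pairs of elements of `T`, the diagonal included. For an edge-coloring
whose diagonal takes one further value these are the colors on `T` together with that value. -/
noncomputable def values {V C : Type*} (φ : V → V → C) (T : Finset V) : Finset C :=
  Finset.image₂ φ T T

theorem mem_values {V C : Type*} {φ : V → V → C} {T : Finset V} {c : C} :
    c ∈ values φ T ↔ ∃ x ∈ T, ∃ y ∈ T, φ x y = c := by
  simp [values, Finset.mem_image₂]

theorem mem_values_of_mem {V C : Type*} {φ : V → V → C} {T : Finset V} {x y : V}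
    (hx : x ∈ T) (hy : y ∈ T) : φ x y ∈ values φ T :=
  mem_values.2 ⟨x, hx, y, hy, rfl⟩

theorem values_mono {V C : Type*} {φ : V → V → C} {T S : Finset V} (h : T ⊆ S) :
    values φ T ⊆ values φ S := by
  intro c hc
  obtain ⟨x, hx, y, hy, rfl⟩ := mem_values.1 hc
  exact mem_values_of_mem (h hx) (h hy)

/-- Every subset `T` of `S` has at least `|T|` values, that is, at least `|T| - 1` colors. -/
def Expanding {V C : Type*} (φ : V → V → C) (S : Finset V) : Prop :=
  ∀ T ⊆ S, T.card ≤ (values φ T).card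

/-- The product of two colorings. -/
def prodColor {V W C D : Type*} (φ : V → V → C) (ψ : W → W → D) (x y : V × W) : C × D :=
  (φ x.1 y.1, ψ x.2 y.2)

/-- The product of `φ` on `S` with any expanding coloring is expanding. Unlike `Expanding` this
property visibly passes to products, which is why it serves as the induction hypothesis. -/
def ProductExpanding {V C : Type*} (φ : V → V → C) (S : Finset V) : Prop :=
  ∀ ⦃X D : Type⦄ (ψ : X → X → D) (U : Finset X), Expanding ψ U →
    Expanding (prodColor φ ψ) (S ×ˢ U)

/-- `φ` refines the pullback of `φ₀` along `j`: values of `φ` on `S` determine those of `φ₀`. -/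
def Refines {V W C D : Type*} (φ : V → V → C) (φ₀ : W → W → D) (j : V → W) (S : Finset V) : Prop :=
  ∀ x ∈ S, ∀ y ∈ S, ∀ z ∈ S, ∀ w ∈ S, φ x y = φ z w → φ₀ (j x) (j y) = φ₀ (j z) (j w)

theorem Refines.mono {V W C D : Type*} {φ : V → V → C} {φ₀ : W → W → D} {j : V → W}
    {S T : Finset V} (h : Refines φ φ₀ j S) (hT : T ⊆ S) : Refines φ φ₀ j T :=
  fun x hx y hy z hz w hw => h x (hT hx) y (hT hy) z (hT hz) w (hT hw)

theorem Refines.exists_map {V W C D : Type*} {φ : V → V → C} {φ₀ : W → W → D} {j : V → W}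
    {S : Finset V} (h : Refines φ φ₀ j S) (hS : S.Nonempty) :
    ∃ τ : C → D, ∀ x ∈ S, ∀ y ∈ S, τ (φ x y) = φ₀ (j x) (j y) := by
  classical
  obtain ⟨v, -⟩ := hS
  refine ⟨fun c => if hc : ∃ q : V × V, q.1 ∈ S ∧ q.2 ∈ S ∧ φ q.1 q.2 = c then
    φ₀ (j hc.choose.1) (j hc.choose.2) else φ₀ (j v) (j v), fun x hx y hy => ?_⟩
  have hc : ∃ q : V × V, q.1 ∈ S ∧ q.2 ∈ S ∧ φ q.1 q.2 = φ x y := ⟨(x, y), hx, hy, rfl⟩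
  simp only [dif_pos hc]
  exact h _ hc.choose_spec.1 _ hc.choose_spec.2.1 _ hx _ hy hc.choose_spec.2.2

theorem Refines.card_values_le {V W C D : Type*} [DecidableEq W] {φ : V → V → C} {φ₀ : W → W → D}
    {j : V → W} {S : Finset V} (h : Refines φ φ₀ j S) :
    (values φ₀ (S.image j)).card ≤ (values φ S).card := by
  classical
  rcases S.eq_empty_or_nonempty with rfl | hS
  · simp [values]
  obtain ⟨τ, hτ⟩ := h.exists_map hS
  refine (Finset.card_le_card (t := (values φ S).image τ) ?_).trans Finset.card_image_le
  intro c hc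
  obtain ⟨x', hx', y', hy', rfl⟩ := mem_values.1 hc
  obtain ⟨x, hx, rfl⟩ := Finset.mem_image.1 hx'
  obtain ⟨y, hy, rfl⟩ := Finset.mem_image.1 hy'
  exact Finset.mem_image.2 ⟨_, mem_values_of_mem hx hy, hτ x hx y hy⟩

/-- If a refinement produces no new values, then it is an equivalence. -/
theorem Refines.eq_of_card_le {V W C D : Type*} [DecidableEq W] {φ : V → V → C}
    {φ₀ : W → W → D} {j : V → W} {S : Finset V} (h : Refines φ φ₀ j S)
    (hcard : (values φ S).card ≤ (values φ₀ (S.image j)).card) {x y z w : V}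
    (hx : x ∈ S) (hy : y ∈ S) (hz : z ∈ S) (hw : w ∈ S)
    (heq : φ₀ (j x) (j y) = φ₀ (j z) (j w)) : φ x y = φ z w := by
  classical
  obtain ⟨τ, hτ⟩ := h.exists_map ⟨x, hx⟩
  have hsub : values φ₀ (S.image j) ⊆ (values φ S).image τ := by
    intro c hc
    obtain ⟨x', hx', y', hy', rfl⟩ := mem_values.1 hc
    obtain ⟨x, hx, rfl⟩ := Finset.mem_image.1 hx'
    obtain ⟨y, hy, rfl⟩ := Finset.mem_image.1 hy'
    exact Finset.mem_image.2 ⟨_, mem_values_of_mem hx hy, hτ x hx y hy⟩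
  have hinj : Set.InjOn τ (values φ S) := Finset.card_image_iff.1
    (le_antisymm Finset.card_image_le (hcard.trans (Finset.card_le_card hsub)))
  exact hinj (mem_values_of_mem hx hy) (mem_values_of_mem hz hw)
    (by rw [hτ x hx y hy, hτ z hz w hw, heq])

theorem Expanding.of_refines {V W C D : Type*} {φ : V → V → C} {φ₀ : W → W → D} {j : V → W}
    {S : Finset V} {S₀ : Finset W} (h₀ : Expanding φ₀ S₀) (hmaps : ∀ x ∈ S, j x ∈ S₀)
    (hinj : Set.InjOn j S) (h : Refines φ φ₀ j S) : Expanding φ S := by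
  classical
  intro T hT
  have h1 : T.card = (T.image j).card := (Finset.card_image_of_injOn (hinj.mono hT)).symm
  rw [h1]
  refine (h₀ _ ?_).trans (h.mono hT).card_values_le
  intro w hw
  obtain ⟨x, hx, rfl⟩ := Finset.mem_image.1 hw
  exact hmaps x (hT hx)

theorem ProductExpanding.of_refines {V W C D : Type*} {φ : V → V → C} {φ₀ : W → W → D}
    {j : V → W} {S : Finset V} {S₀ : Finset W} (h₀ : ProductExpanding φ₀ S₀)
    (hmaps : ∀ x ∈ S, j x ∈ S₀) (hinj : Set.InjOn j S) (h : Refines φ φ₀ j S) :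
    ProductExpanding φ S := by
  intro X E ψ U hU
  refine (h₀ ψ U hU).of_refines (j := Prod.map j id) ?_ ?_ ?_
  · rintro ⟨x, a⟩ hx
    simp only [Finset.mem_product] at hx
    simpa using ⟨hmaps x hx.1, hx.2⟩
  · rintro ⟨x, a⟩ hx ⟨y, b⟩ hy hxy
    simp only [Finset.coe_product, Set.mem_prod, Finset.mem_coe] at hx hy
    simp only [Prod.map_apply, id, Prod.mk.injEq] at hxy
    exact Prod.ext (hinj hx.1 hy.1 hxy.1) hxy.2
  · rintro ⟨x, a⟩ hx ⟨y, b⟩ hy ⟨z, c⟩ hz ⟨w, d⟩ hw heq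
    simp only [Finset.mem_product] at hx hy hz hw
    simp only [prodColor, Prod.mk.injEq, Prod.map_apply, id] at heq ⊢
    exact ⟨h x hx.1 y hy.1 z hz.1 w hw.1 heq.1, heq.2⟩

theorem ProductExpanding.expanding {V C : Type*} {φ : V → V → C} {S : Finset V}
    (h : ProductExpanding φ S) : Expanding φ S := by
  refine (h (fun _ _ : Unit => ()) Finset.univ ?_).of_refines (j := fun x => (x, ())) ?_ ?_ ?_
  · intro T _
    rcases T.eq_empty_or_nonempty with rfl | ⟨x, hx⟩
    · simp
    · exact Finset.card_le_one_of_subsingleton T |>.trans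
        (Finset.card_pos.2 ⟨_, mem_values_of_mem hx hx⟩)
  · intro x hx
    simpa using hx
  · intro x _ y _ hxy
    simpa using hxy
  · intro x _ y _ z _ w _ heq
    simpa [prodColor] using heq

theorem ProductExpanding.prod {V W C D : Type} {φ : V → V → C} {φ₀ : W → W → D} {S : Finset V}
    {S₀ : Finset W} (h : ProductExpanding φ S) (h₀ : ProductExpanding φ₀ S₀) :
    ProductExpanding (prodColor φ φ₀) (S ×ˢ S₀) := by
  intro X E ψ U hU
  refine (h _ _ (h₀ ψ U hU)).of_refines (j := fun q => (q.1.1, q.1.2, q.2)) ?_ ?_ ?_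
  · rintro ⟨⟨x, y⟩, a⟩ hx
    simpa [and_assoc] using hx
  · rintro ⟨⟨x, y⟩, a⟩ _ ⟨⟨x', y'⟩, a'⟩ _ heq
    simp only [Prod.mk.injEq] at heq ⊢
    tauto
  · rintro x _ y _ z _ w _ heq
    simp only [prodColor, Prod.mk.injEq] at heq ⊢
    tauto

theorem productExpanding_of_card_le_one {V C : Type*} (φ : V → V → C) {S : Finset V}
    (hS : S.card ≤ 1) : ProductExpanding φ S := by
  intro X D ψ U hU
  refine hU.of_refines (j := Prod.snd) ?_ ?_ ?_
  · rintro ⟨x, a⟩ hx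
    exact (Finset.mem_product.1 hx).2
  · rintro ⟨x, a⟩ hx ⟨y, b⟩ hy heq
    simp only [Finset.coe_product, Set.mem_prod, Finset.mem_coe] at hx hy
    exact Prod.ext (Finset.card_le_one.1 hS x hx.1 y hy.1) heq
  · rintro x _ y _ z _ w _ heq
    exact congrArg Prod.snd heq

/-- Splitting the vertex `x₁` into twins `x₀`, `x₁`, joined by a color that occurs nowhere else,
preserves `ProductExpanding`. For `T ⊆ S × U` with fibers `A`, `B` over the twins, identifying the
twins loses the `|A ∩ B|` elements that occur twice; in return, values of `ψ` between `A` and `B`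
occur next to the new color, and those on `A ∩ B` occur also next to the diagonal value. -/
theorem ProductExpanding.of_twin {V C C₀ : Type*} {φ : V → V → C} {φ₀ : V → V → C₀}
    {S S₀ : Finset V} {ρ : V → V} {x₀ x₁ : V}
    (h : ProductExpanding φ₀ S₀) (hmaps : ∀ x ∈ S, ρ x ∈ S₀)
    (hx₀ : x₀ ∈ S) (hx₁ : x₁ ∈ S) (hne : x₀ ≠ x₁) (hρ : ρ x₀ = x₁)
    (hρ' : ∀ x, x ≠ x₀ → ρ x = x) (href : Refines φ φ₀ ρ S)
    (hsymm : φ x₁ x₀ = φ x₀ x₁)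
    (huniq : ∀ x ∈ S, ∀ y ∈ S, φ x y = φ x₀ x₁ → s(x, y) = s(x₀, x₁)) :
    ProductExpanding φ S := by
  classical
  intro X D ψ U hU T hT
  obtain ⟨τ, hτ⟩ := href.exists_map ⟨x₀, hx₀⟩
  have hTS : ∀ q ∈ T, q.1 ∈ S := fun q hq => (Finset.mem_product.1 (hT hq)).1
  have hTU : ∀ q ∈ T, q.2 ∈ U := fun q hq => (Finset.mem_product.1 (hT hq)).2
  set e := φ x₀ x₁ with he
  set z := φ₀ x₁ x₁ with hz
  have hρ₁ : ρ x₁ = x₁ := hρ' x₁ hne.symm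
  set I : Finset X := U.filter fun a => (x₀, a) ∈ T ∧ (x₁, a) ∈ T with hI
  set T₀ := T.image (Prod.map ρ id) with hT₀
  set H := values (prodColor φ ψ) T with hH
  set He := H.filter fun c => c.1 = e with hHe
  set Hn := H.filter fun c => ¬ c.1 = e with hHn
  -- Only the pairs of twins in `I` are identified by `ρ`.
  have hcardT : T.card ≤ T₀.card + I.card := by
    set T₁ := T.filter fun q => ¬ (q.1 = x₀ ∧ q.2 ∈ I) with hT₁
    have h1 : T.card = T₁.card + (T.filter fun q => q.1 = x₀ ∧ q.2 ∈ I).card := by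
      rw [add_comm]
      exact (Finset.card_filter_add_card_filter_not _).symm
    have h2 : (T.filter fun q => q.1 = x₀ ∧ q.2 ∈ I).card ≤ I.card := by
      refine Finset.card_le_card_of_injOn Prod.snd ?_ ?_
      · intro q hq
        exact (Finset.mem_filter.1 hq).2.2
      · intro q hq q' hq' heq
        have := (Finset.mem_filter.1 hq).2.1
        have := (Finset.mem_filter.1 hq').2.1
        exact Prod.ext (by simp_all) heq
    have h3 : T₁.card ≤ T₀.card := by
      refine Finset.card_le_card_of_injOn (Prod.map ρ id) ?_ ?_
      · intro q hq
        exact Finset.mem_image_of_mem _ (Finset.mem_filter.1 hq).1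
      · rintro ⟨x, a⟩ hq ⟨y, b⟩ hq' heq
        obtain ⟨hm, hqn⟩ := Finset.mem_filter.1 hq
        obtain ⟨hm', hqn'⟩ := Finset.mem_filter.1 hq'
        simp only [Prod.map_apply, id, Prod.mk.injEq] at heq
        obtain ⟨hxy, rfl⟩ := heq
        have haU := hTU _ hm
        simp only [hI, Finset.mem_filter] at hqn hqn'
        by_cases hx : x = x₀ <;> by_cases hy : y = x₀
        · rw [hx, hy]
        · subst hx
          rw [hρ, hρ' y hy] at hxy
          subst hxy
          exact absurd ⟨rfl, haU, hm, hm'⟩ hqn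
        · subst hy
          rw [hρ, hρ' x hx] at hxy
          subst hxy
          exact absurd ⟨rfl, haU, hm', hm⟩ hqn'
        · rw [hρ' x hx, hρ' y hy] at hxy
          rw [hxy]
    omega
  have hT₀card : T₀.card ≤ (values (prodColor φ₀ ψ) T₀).card := by
    refine h ψ U hU T₀ ?_
    intro q' hq'
    obtain ⟨q, hq, rfl⟩ := Finset.mem_image.1 hq'
    exact Finset.mem_product.2 ⟨hmaps _ (hTS q hq), hTU q hq⟩
  set Q := He.image fun c => (z, c.2) with hQ
  set N := Hn.image fun c => (τ c.1, c.2) with hN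
  have hcover : values (prodColor φ₀ ψ) T₀ ⊆ N ∪ Q := by
    intro c hc
    obtain ⟨p, hp, p', hp', rfl⟩ := mem_values.1 hc
    obtain ⟨⟨x, a⟩, hq, rfl⟩ := Finset.mem_image.1 hp
    obtain ⟨⟨y, b⟩, hq', rfl⟩ := Finset.mem_image.1 hp'
    have hmem : (φ x y, ψ a b) ∈ H := mem_values_of_mem hq hq'
    have hτe := hτ x (hTS _ hq) y (hTS _ hq')
    by_cases hxy : φ x y = e
    · refine Finset.mem_union_right _ (Finset.mem_image.2
        ⟨(φ x y, ψ a b), Finset.mem_filter.2 ⟨hmem, hxy⟩, ?_⟩)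
      have hs := huniq x (hTS _ hq) y (hTS _ hq') hxy
      rw [Sym2.eq_iff] at hs
      rcases hs with ⟨rfl, rfl⟩ | ⟨rfl, rfl⟩ <;> simp [prodColor, hρ, hρ₁, hz]
    · exact Finset.mem_union_left _ (Finset.mem_image.2
        ⟨(φ x y, ψ a b), Finset.mem_filter.2 ⟨hmem, hxy⟩, by simp [prodColor, hτe]⟩)
  have hinter : I.card ≤ (N ∩ Q).card := by
    refine (hU I (Finset.filter_subset _ _)).trans ?_
    refine Finset.card_le_card_of_injOn (fun c => (z, c)) ?_ ?_
    · intro c hc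
      obtain ⟨a, ha, b, hb, rfl⟩ := mem_values.1 hc
      obtain ⟨-, ha₀, ha₁⟩ := Finset.mem_filter.1 ha
      obtain ⟨-, hb₀, hb₁⟩ := Finset.mem_filter.1 hb
      refine Finset.mem_inter.2 ⟨Finset.mem_image.2 ⟨(φ x₀ x₀, ψ a b), Finset.mem_filter.2
        ⟨mem_values_of_mem ha₀ hb₀, ?_⟩, ?_⟩, Finset.mem_image.2 ⟨(e, ψ a b), Finset.mem_filter.2
        ⟨mem_values_of_mem ha₀ hb₁, rfl⟩, rfl⟩⟩
      · intro hcon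
        have := huniq _ hx₀ _ hx₀ hcon
        rw [Sym2.eq_iff] at this
        rcases this with h' | h'
        · exact hne h'.2
        · exact hne h'.1
      · simp [hτ _ hx₀ _ hx₀, hρ, hz]
    · intro c _ c' _ heq
      exact (Prod.mk.inj heq).2
  have hQcard : Q.card ≤ He.card := Finset.card_image_le
  have hNcard : N.card ≤ Hn.card := Finset.card_image_le
  have hHcard : He.card + Hn.card = H.card := Finset.card_filter_add_card_filter_not _
  have h1 := Finset.card_le_card hcover
  have h2 := Finset.card_union_add_card_inter N Q
  omega

open Classical in
/-- The pullback of `φ'` along `π`, refined by giving every pair inside a fiber of `π` a color of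
its own. -/
noncomputable def fiberColor {V W C : Type*} (φ' : W → W → C) (π : V → W) (x y : V) :
    C × Option (Sym2 V) :=
  (φ' (π x) (π y), if π x = π y ∧ x ≠ y then some s(x, y) else none)

theorem productExpanding_fiberColor {V W C : Type*} [DecidableEq W] {φ' : W → W → C} {π : V → W}
    {S : Finset V} (h : ProductExpanding φ' (S.image π)) :
    ProductExpanding (fiberColor φ' π) S := by
  classical
  induction hn : S.card using Nat.strong_induction_on generalizing S with
  | _ n ih =>
    subst hn
    by_cases hinj : Set.InjOn π S
    · refine h.of_refines (fun x hx => Finset.mem_image_of_mem π hx) hinj ?_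
      intro x _ y _ z _ w _ heq
      exact congrArg Prod.fst heq
    · obtain ⟨x₀, hx₀, x₁, hx₁, hπ, hne⟩ :
          ∃ x₀ ∈ S, ∃ x₁ ∈ S, π x₀ = π x₁ ∧ x₀ ≠ x₁ := by
        simpa [Set.InjOn] using hinj
      have himg : (S.erase x₀).image π ⊆ S.image π := Finset.image_subset_image (S.erase_subset x₀)
      have hprod : ProductExpanding φ' ((S.erase x₀).image π) :=
        h.of_refines (j := id) (fun x hx => himg hx) (Set.injOn_id _) (by
          intro x _ y _ z _ w _ heq; exact heq)
      have h₀ := ih _ (Finset.card_erase_lt_of_mem hx₀) hprod rfl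
      have hρπ : ∀ x, π (if x = x₀ then x₁ else x) = π x := by
        intro x
        split_ifs with hx
        · rw [hx, hπ]
        · rfl
      refine h₀.of_twin (ρ := fun x => if x = x₀ then x₁ else x) (x₀ := x₀) (x₁ := x₁)
        ?_ hx₀ hx₁ hne (by simp) (fun x hx => by simp [hx]) ?_ ?_ ?_
      · intro x hx
        by_cases hxx : x = x₀
        · simpa [hxx] using ⟨hne.symm, hx₁⟩
        · simpa [hxx] using hx
      · intro x _ y _ z _ w _ heq
        simp only [fiberColor, hρπ, Prod.mk.injEq] at heq ⊢
        refine ⟨heq.1, ?_⟩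
        have h2 := heq.2
        by_cases hxy : π x = π y ∧ x ≠ y <;> by_cases hzw : π z = π w ∧ z ≠ w
        · rw [if_pos hxy, if_pos hzw, Option.some.injEq, Sym2.eq_iff] at h2
          rcases h2 with ⟨rfl, rfl⟩ | ⟨rfl, rfl⟩
          · rfl
          · simp only [Sym2.eq_swap (a := if x = x₀ then x₁ else x), eq_comm (a := π x),
              ne_comm (a := if x = x₀ then x₁ else x)]
        · simp [hxy, hzw] at h2
        · simp [hxy, hzw] at h2
        · have aux : ∀ x y, ¬ (π x = π y ∧ x ≠ y) → ¬ (π x = π y ∧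
              (if x = x₀ then x₁ else x) ≠ (if y = x₀ then x₁ else y)) := by
            intro x y hn hc
            refine hn ⟨hc.1, ?_⟩
            rintro rfl
            exact hc.2 rfl
          rw [if_neg (aux x y hxy), if_neg (aux z w hzw)]
      · simp [fiberColor, hπ, hne, hne.symm, Sym2.eq_swap]
      · intro x _ y _ heq
        have h2 := congrArg Prod.snd heq
        simp only [fiberColor, hπ, hne, ne_eq, not_false_eq_true, and_self, if_true] at h2
        split_ifs at h2
        exact Option.some.inj h2

/-- `ProductExpanding` lifts along `π` if the color of a pair inside a fiber of `π` determines
that pair. -/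
theorem ProductExpanding.of_fibers {V W C D : Type*} [DecidableEq W] {φ : V → V → C}
    {φ' : W → W → D} {π : V → W} {S : Finset V} (h : ProductExpanding φ' (S.image π))
    (href : Refines φ φ' π S)
    (huniq : ∀ x ∈ S, ∀ y ∈ S, ∀ z ∈ S, ∀ w ∈ S, x ≠ y → π x = π y → φ x y = φ z w →
      s(x, y) = s(z, w)) : ProductExpanding φ S := by
  classical
  refine (productExpanding_fiberColor h).of_refines (j := id) (fun x hx => hx)
    (Set.injOn_id _) ?_
  intro x hx y hy z hz w hw heq
  simp only [fiberColor, id, Prod.mk.injEq]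
  refine ⟨href x hx y hy z hz w hw heq, ?_⟩
  by_cases hxy : π x = π y ∧ x ≠ y
  · have hs := huniq x hx y hy z hz w hw hxy.2 hxy.1 heq
    rw [Sym2.eq_iff] at hs
    rcases hs with ⟨rfl, rfl⟩ | ⟨rfl, rfl⟩
    · rfl
    · simp only [Sym2.eq_swap (a := x), eq_comm (a := π x), ne_comm (a := x)]
  · by_cases hzw : π z = π w ∧ z ≠ w
    · have hs := huniq z hz w hw x hx y hy hzw.2 hzw.1 heq.symm
      rw [Sym2.eq_iff] at hs
      rcases hs with ⟨rfl, rfl⟩ | ⟨rfl, rfl⟩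
      · rfl
      · exact absurd ⟨hzw.1.symm, hzw.2.symm⟩ hxy
    · rw [if_neg hxy, if_neg hzw]

/-! ### Blocks -/

theorem getElem?_block {r i : ℕ} {x : List Bool} {k : ℕ} (hk : k < r) :
    (block r i x)[k]? = x[i * r + k]? := by
  simp [block, hk, List.getElem?_drop]

theorem eq_of_block_eq {r : ℕ} (hr : 0 < r) {x y : List Bool}
    (h : ∀ i, block r i x = block r i y) : x = y := by
  refine List.ext_getElem? fun n => ?_
  have h1 := congrArg (fun l => l[n % r]?) (h (n / r))
  simp only [getElem?_block (Nat.mod_lt n hr)] at h1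
  rwa [Nat.div_add_mod'] at h1

theorem block_eq_nil {r i : ℕ} {x : List Bool} (h : x.length ≤ i * r) : block r i x = [] := by
  simp [block, List.drop_eq_nil_of_le h]

theorem block_take_of_lt {r a i : ℕ} (x : List Bool) (h : i < a) :
    block r i (x.take (a * r)) = block r i x := by
  have h1 : i * r + r ≤ a * r := by
    calc i * r + r = (i + 1) * r := by ring
      _ ≤ a * r := Nat.mul_le_mul_right r h
  rw [block, block, List.drop_take, List.take_take, min_eq_left (by omega)]

theorem block_take_of_le {r a i : ℕ} (x : List Bool) (h : a ≤ i) :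
    block r i (x.take (a * r)) = [] := by
  refine block_eq_nil ((List.length_take_le _ _).trans (Nat.mul_le_mul_right r h))

theorem block_last {r a : ℕ} {x : List Bool} (h : x.length ≤ a * r + r) :
    block r a x = x.drop (a * r) := by
  rw [block, List.take_of_length_le]
  rw [List.length_drop]
  omega

/-- Blocks of blocks are blocks. -/
theorem block_block {s m i j : ℕ} (x : List Bool) (hi : i < m) :
    block s i (block (s * m) j x) = block s (j * m + i) x := by
  have h1 : i * s + s ≤ s * m := by
    calc i * s + s = s * (i + 1) := by ring
      _ ≤ s * m := Nat.mul_le_mul_left s hi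
  rw [block, block, block, List.drop_take, List.take_take, List.drop_drop, min_eq_left (by omega)]
  congr 2
  ring

theorem block_block_of_le {s m i j : ℕ} (x : List Bool) (hi : m ≤ i) :
    block s i (block (s * m) j x) = [] := by
  refine block_eq_nil ?_
  rw [block]
  refine (List.length_take_le _ _).trans ?_
  rw [mul_comm]
  exact Nat.mul_le_mul_right s hi

/-! ### The function `η` -/

@[simp]
theorem eta_self (r : ℕ) (x : List Bool) : eta r x x = none := by
  simp [eta]

theorem eta_eq_none {r : ℕ} {x y : List Bool} : eta r x y = none ↔ x = y := by
  unfold eta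
  split_ifs with h <;> simp [h]

theorem eta_eq_some {r i : ℕ} {x y : List Bool} (hlt : ∀ j < i, block r j x = block r j y)
    (hi : block r i x ≠ block r i y) : eta r x y = some (i, s(block r i x, block r i y)) := by
  have hxy : x ≠ y := by
    rintro rfl
    exact hi rfl
  have hinf : sInf {i : ℕ | block r i x ≠ block r i y} = i := by
    refine le_antisymm (Nat.sInf_le hi) ?_
    by_contra hcon
    exact Nat.sInf_mem (s := {i : ℕ | block r i x ≠ block r i y}) ⟨i, hi⟩ (hlt _ (not_le.1 hcon))
  simp only [eta, if_neg hxy, hinf]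

theorem exists_first_block_ne {r : ℕ} (hr : 0 < r) {x y : List Bool} (h : x ≠ y) :
    ∃ i, (∀ j < i, block r j x = block r j y) ∧ block r i x ≠ block r i y := by
  classical
  have hex : ∃ i, block r i x ≠ block r i y := by
    by_contra hcon
    push Not at hcon
    exact h (eq_of_block_eq hr hcon)
  exact ⟨Nat.find hex, fun j hj => not_not.1 (Nat.find_min hex hj), Nat.find_spec hex⟩

/-- If two strings differ before the block `a`, then `η` does not see the rest. -/
theorem eta_take {r a : ℕ} (hr : 0 < r) {x y : List Bool}
    (h : x.take (a * r) ≠ y.take (a * r)) :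
    eta r (x.take (a * r)) (y.take (a * r)) = eta r x y ∧
      ∃ i < a, ∃ q, eta r x y = some (i, q) := by
  obtain ⟨i, hlt, hi⟩ := exists_first_block_ne hr h
  have hia : i < a := by
    by_contra hcon
    exact hi (by rw [block_take_of_le _ (not_lt.1 hcon), block_take_of_le _ (not_lt.1 hcon)])
  have h1 := eta_eq_some hlt hi
  rw [block_take_of_lt _ hia, block_take_of_lt _ hia] at hi h1
  have h2 := eta_eq_some (r := r) (i := i) (x := x) (y := y) (fun j hj => by
    have := hlt j hj
    rwa [block_take_of_lt _ (hj.trans hia), block_take_of_lt _ (hj.trans hia)] at this) hi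
  exact ⟨h1.trans h2.symm, i, hia, _, h2⟩

/-- The value of `η` on two strings that differ only in the last block. -/
theorem eta_of_take_eq {r a : ℕ} {x y : List Bool} (hx : x.length ≤ a * r + r)
    (hy : y.length ≤ a * r + r) (hne : x ≠ y) (h : x.take (a * r) = y.take (a * r)) :
    eta r x y = some (a, s(x.drop (a * r), y.drop (a * r))) := by
  have h1 := eta_eq_some (r := r) (i := a) (x := x) (y := y) ?_ ?_
  · rwa [block_last hx, block_last hy] at h1
  · intro j hj
    rw [← block_take_of_lt x hj, ← block_take_of_lt y hj, h]
  · rw [block_last hx, block_last hy]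
    intro hd
    exact hne (by rw [← List.take_append_drop (a * r) x, ← List.take_append_drop (a * r) y, h, hd])

/-- `η` determines whether two strings differ only in their last block, and which last blocks
these are. -/
theorem eta_last {r a : ℕ} (hr : 0 < r) {x y z w : List Bool} (hx : x.length ≤ a * r + r)
    (hy : y.length ≤ a * r + r) (hz : z.length ≤ a * r + r) (hw : w.length ≤ a * r + r)
    (hne : x ≠ y) (h : x.take (a * r) = y.take (a * r)) (heq : eta r x y = eta r z w) :
    z.take (a * r) = w.take (a * r) ∧
      s(x.drop (a * r), y.drop (a * r)) = s(z.drop (a * r), w.drop (a * r)) := by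
  have h1 := eta_of_take_eq hx hy hne h
  have hzw : z ≠ w := by
    rintro rfl
    rw [h1, eta_self] at heq
    cases heq
  have h2 : z.take (a * r) = w.take (a * r) := by
    by_contra hcon
    obtain ⟨-, i, hi, q, hq⟩ := eta_take hr hcon
    rw [h1, hq, Option.some.injEq, Prod.mk.injEq] at heq
    omega
  refine ⟨h2, ?_⟩
  rw [h1, eta_of_take_eq hz hw hzw h2, Option.some.injEq, Prod.mk.injEq] at heq
  exact heq.2

/-- `η` of two strings determines `η` of their prefixes. -/
theorem eta_take_eq {r a : ℕ} (hr : 0 < r) {x y z w : List Bool} (hx : x.length ≤ a * r + r)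
    (hy : y.length ≤ a * r + r) (hz : z.length ≤ a * r + r) (hw : w.length ≤ a * r + r)
    (heq : eta r x y = eta r z w) :
    eta r (x.take (a * r)) (y.take (a * r)) = eta r (z.take (a * r)) (w.take (a * r)) := by
  have aux : ∀ {x y z w : List Bool}, x.length ≤ a * r + r → y.length ≤ a * r + r →
      z.length ≤ a * r + r → w.length ≤ a * r + r → eta r x y = eta r z w →
      x.take (a * r) = y.take (a * r) → z.take (a * r) = w.take (a * r) := by
    intro x y z w hx hy hz hw heq h
    by_cases hxy : x = y
    · rw [eta_eq_none.2 hxy] at heq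
      rw [eta_eq_none.1 heq.symm]
    · exact (eta_last hr hx hy hz hw hxy h heq).1
  by_cases h : x.take (a * r) = y.take (a * r)
  · rw [eta_eq_none.2 h, eta_eq_none.2 (aux hx hy hz hw heq h)]
  · have h' : z.take (a * r) ≠ w.take (a * r) := fun h' => h (aux hz hw hx hy heq.symm h')
    rw [(eta_take hr h).1, (eta_take hr h').1, heq]

/-! ### A recursive form of the coloring -/

/-- The colors of `recColor`. -/
def ColorType : ℕ → Type
  | 0 => Option (ℕ × Sym2 (List Bool))
  | p + 1 => Option (ℕ × Sym2 (List Bool)) × (ℕ → ColorType p)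

/-- A recursive form of the coloring `c_p` with block lengths `ρ 0 ∣ ρ 1 ∣ … ∣ ρ p`: the value
of `η_p` together with the `c_{p-1}`-colors of all pairs of corresponding `ρ p`-blocks. It does
not refer to the length of the strings, so that it applies to prefixes and to single blocks. -/
noncomputable def recColor (ρ : ℕ → ℕ) : (p : ℕ) → List Bool → List Bool → ColorType p
  | 0 => eta (ρ 0)
  | p + 1 => fun x y =>
      (eta (ρ (p + 1)) x y, fun i => recColor ρ p (block (ρ (p + 1)) i x) (block (ρ (p + 1)) i y))

theorem recColor_succ_eq_iff {ρ : ℕ → ℕ} {p : ℕ} {x y z w : List Bool} :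
    recColor ρ (p + 1) x y = recColor ρ (p + 1) z w ↔
      eta (ρ (p + 1)) x y = eta (ρ (p + 1)) z w ∧
        ∀ i, recColor ρ p (block (ρ (p + 1)) i x) (block (ρ (p + 1)) i y) =
          recColor ρ p (block (ρ (p + 1)) i z) (block (ρ (p + 1)) i w) :=
  ⟨fun h => ⟨congrArg Prod.fst h, fun i => congrFun (congrArg Prod.snd h) i⟩,
    fun h => Prod.ext h.1 (funext h.2)⟩

theorem recColor_comm (ρ : ℕ → ℕ) (p : ℕ) (x y : List Bool) :
    recColor ρ p x y = recColor ρ p y x := by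
  induction p generalizing x y with
  | zero => exact eta_comm _ _ _
  | succ p ih => exact Prod.ext (eta_comm _ _ _) (funext fun i => ih _ _)

theorem recColor_self (ρ : ℕ → ℕ) (p : ℕ) (x y : List Bool) :
    recColor ρ p x x = recColor ρ p y y := by
  induction p generalizing x y with
  | zero => exact (eta_self _ _).trans (eta_self _ _).symm
  | succ p ih => exact Prod.ext ((eta_self _ _).trans (eta_self _ _).symm) (funext fun i => ih _ _)

theorem eta_eq_of_recColor_eq {ρ : ℕ → ℕ} {p : ℕ} {x y z w : List Bool}
    (h : recColor ρ p x y = recColor ρ p z w) : eta (ρ p) x y = eta (ρ p) z w := by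
  cases p with
  | zero => exact h
  | succ p => exact congrArg Prod.fst h

theorem recColor_eq_self {ρ : ℕ → ℕ} {p : ℕ} {x y z : List Bool} :
    recColor ρ p x y = recColor ρ p z z ↔ x = y := by
  constructor
  · intro h
    have := eta_eq_of_recColor_eq h
    rwa [eta_self, eta_eq_none] at this
  · rintro rfl
    exact recColor_self _ _ _ _

theorem recColor_take {ρ : ℕ → ℕ} {p a : ℕ} (hρ : 0 < ρ p) {x y z w : List Bool}
    (hx : x.length ≤ a * ρ p + ρ p) (hy : y.length ≤ a * ρ p + ρ p)
    (hz : z.length ≤ a * ρ p + ρ p) (hw : w.length ≤ a * ρ p + ρ p)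
    (h : recColor ρ p x y = recColor ρ p z w) :
    recColor ρ p (x.take (a * ρ p)) (y.take (a * ρ p)) =
      recColor ρ p (z.take (a * ρ p)) (w.take (a * ρ p)) := by
  have h1 := eta_take_eq hρ hx hy hz hw (eta_eq_of_recColor_eq h)
  cases p with
  | zero => exact h1
  | succ p =>
    refine recColor_succ_eq_iff.2 ⟨h1, fun i => ?_⟩
    by_cases hi : i < a
    · simpa [block_take_of_lt _ hi] using (recColor_succ_eq_iff.1 h).2 i
    · simp [block_take_of_le _ (not_lt.1 hi)]

theorem recColor_drop {ρ : ℕ → ℕ} {p a : ℕ} {x y z w : List Bool}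
    (hx : x.length ≤ a * ρ (p + 1) + ρ (p + 1)) (hy : y.length ≤ a * ρ (p + 1) + ρ (p + 1))
    (hz : z.length ≤ a * ρ (p + 1) + ρ (p + 1)) (hw : w.length ≤ a * ρ (p + 1) + ρ (p + 1))
    (h : recColor ρ (p + 1) x y = recColor ρ (p + 1) z w) :
    recColor ρ p (x.drop (a * ρ (p + 1))) (y.drop (a * ρ (p + 1))) =
      recColor ρ p (z.drop (a * ρ (p + 1))) (w.drop (a * ρ (p + 1))) := by
  have := (recColor_succ_eq_iff.1 h).2 a
  simpa [block_last hx, block_last hy, block_last hz, block_last hw] using this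

/-- For strings with different prefixes, the colors of the prefixes and of the last blocks
determine the color. -/
theorem recColor_eq_of_take_of_drop {ρ : ℕ → ℕ} {p a : ℕ} (hρ : 0 < ρ (p + 1))
    {x y z w : List Bool}
    (hx : x.length ≤ a * ρ (p + 1) + ρ (p + 1)) (hy : y.length ≤ a * ρ (p + 1) + ρ (p + 1))
    (hz : z.length ≤ a * ρ (p + 1) + ρ (p + 1)) (hw : w.length ≤ a * ρ (p + 1) + ρ (p + 1))
    (hxy : x.take (a * ρ (p + 1)) ≠ y.take (a * ρ (p + 1)))
    (htake : recColor ρ (p + 1) (x.take (a * ρ (p + 1))) (y.take (a * ρ (p + 1))) =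
      recColor ρ (p + 1) (z.take (a * ρ (p + 1))) (w.take (a * ρ (p + 1))))
    (hdrop : recColor ρ p (x.drop (a * ρ (p + 1))) (y.drop (a * ρ (p + 1))) =
      recColor ρ p (z.drop (a * ρ (p + 1))) (w.drop (a * ρ (p + 1)))) :
    recColor ρ (p + 1) x y = recColor ρ (p + 1) z w := by
  have hzw : z.take (a * ρ (p + 1)) ≠ w.take (a * ρ (p + 1)) := by
    intro hcon
    rw [hcon] at htake
    exact hxy (recColor_eq_self.1 htake)
  have he := eta_eq_of_recColor_eq htake
  rw [(eta_take hρ hxy).1, (eta_take hρ hzw).1] at he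
  refine recColor_succ_eq_iff.2 ⟨he, fun i => ?_⟩
  rcases lt_trichotomy i a with hi | rfl | hi
  · have := (recColor_succ_eq_iff.1 htake).2 i
    simpa [block_take_of_lt _ hi] using this
  · simpa [block_last hx, block_last hy, block_last hz, block_last hw] using hdrop
  · have h1 : a * ρ (p + 1) + ρ (p + 1) ≤ i * ρ (p + 1) := by
      calc a * ρ (p + 1) + ρ (p + 1) = (a + 1) * ρ (p + 1) := by ring
        _ ≤ i * ρ (p + 1) := Nat.mul_le_mul_right _ hi
    simp only [block_eq_nil (hx.trans h1), block_eq_nil (hy.trans h1),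
      block_eq_nil (hz.trans h1), block_eq_nil (hw.trans h1)]

/-- Unfolding the recursion: `recColor` records `η_d` on all `ρ (d + 1)`-blocks for `d < p`,
and `η_p` on the whole strings. -/
theorem recColor_eq_iff {ρ : ℕ → ℕ} {p : ℕ} (hpos : ∀ d ≤ p, 0 < ρ d)
    (hdvd : ∀ d < p, ρ d ∣ ρ (d + 1)) {x y z w : List Bool} :
    recColor ρ p x y = recColor ρ p z w ↔ eta (ρ p) x y = eta (ρ p) z w ∧
      ∀ d < p, ∀ i, eta (ρ d) (block (ρ (d + 1)) i x) (block (ρ (d + 1)) i y) =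
        eta (ρ d) (block (ρ (d + 1)) i z) (block (ρ (d + 1)) i w) := by
  induction p generalizing x y z w with
  | zero => exact ⟨fun h => ⟨h, fun d hd => absurd hd (Nat.not_lt_zero d)⟩, fun h => h.1⟩
  | succ p ih =>
    have ih' := fun x y z w => @ih (fun d hd => hpos d (by omega)) (fun d hd => hdvd d (by omega))
      x y z w
    have hchain : ∀ d, d < p → ρ (d + 1) ∣ ρ (p + 1) := by
      intro d hd
      have : ∀ k, d + 1 + k ≤ p + 1 → ρ (d + 1) ∣ ρ (d + 1 + k) := by
        intro k
        induction k with
        | zero => intro _; exact dvd_rfl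
        | succ k ihk => intro hk; exact (ihk (by omega)).trans (hdvd (d + 1 + k) (by omega))
      have h := this (p - d) (by omega)
      rwa [show d + 1 + (p - d) = p + 1 by omega] at h
    simp only [recColor_succ_eq_iff, ih']
    refine and_congr_right fun _ => ⟨fun h d hd i => ?_, fun h j => ⟨h p (by omega) j, ?_⟩⟩
    · rcases Nat.lt_succ_iff_lt_or_eq.1 hd with hd | rfl
      · obtain ⟨m, hm⟩ := hchain d hd
        have hm0 : 0 < m := by
          rcases Nat.eq_zero_or_pos m with rfl | h0
          · have := hpos (p + 1) le_rfl
            omega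
          · exact h0
        have h1 := (h (i / m)).2 d hd (i % m)
        simp only [hm, block_block _ (Nat.mod_lt i hm0)] at h1
        rwa [Nat.div_add_mod'] at h1
      · exact (h i).1
    · intro d hd i
      obtain ⟨m, hm⟩ := hchain d hd
      rw [hm]
      by_cases hi : i < m
      · simpa only [block_block _ hi] using h d (by omega) (j * m + i)
      · simp [block_block_of_le _ (not_lt.1 hi)]

/-! ### The lower bound on the number of colors -/

/-- A string of positive length is a nonempty last block preceded by full blocks. -/
theorem exists_length_split {R α : ℕ} (hR : 0 < R) (hα : 0 < α) :
    ∃ a, a * R < α ∧ α ≤ a * R + R := by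
  refine ⟨(α - 1) / R, ?_, ?_⟩
  · have := Nat.div_mul_le_self (α - 1) R
    omega
  · have := Nat.lt_div_mul_add (a := α - 1) hR
    omega

/-- If the color of a pair `x`, `y` with equal prefixes also occurs on another pair, then that
other pair has the same two last blocks, behind a different prefix. -/
theorem exists_of_recColor_eq {ρ : ℕ → ℕ} {p a : ℕ} (hρ : 0 < ρ p) {x y z w : List Bool}
    (hx : x.length ≤ a * ρ p + ρ p) (hy : y.length ≤ a * ρ p + ρ p)
    (hz : z.length ≤ a * ρ p + ρ p) (hw : w.length ≤ a * ρ p + ρ p)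
    (hne : x ≠ y) (htake : x.take (a * ρ p) = y.take (a * ρ p))
    (h : recColor ρ p x y = recColor ρ p z w) (hs : s(x, y) ≠ s(z, w)) :
    ∃ z' w', s(z', w') = s(z, w) ∧ z'.take (a * ρ p) = w'.take (a * ρ p) ∧
      x.drop (a * ρ p) = z'.drop (a * ρ p) ∧ y.drop (a * ρ p) = w'.drop (a * ρ p) ∧
      x.take (a * ρ p) ≠ z'.take (a * ρ p) := by
  obtain ⟨h1, h2⟩ := eta_last hρ hx hy hz hw hne htake (eta_eq_of_recColor_eq h)
  have aux : ∀ z' w' : List Bool, s(z', w') = s(z, w) → z'.take (a * ρ p) = w'.take (a * ρ p) →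
      x.drop (a * ρ p) = z'.drop (a * ρ p) → y.drop (a * ρ p) = w'.drop (a * ρ p) →
      x.take (a * ρ p) ≠ z'.take (a * ρ p) := by
    intro z' w' hs' ht hd hd' hcon
    refine hs (hs' ▸ ?_)
    rw [← List.take_append_drop (a * ρ p) x, ← List.take_append_drop (a * ρ p) y,
      ← List.take_append_drop (a * ρ p) z', ← List.take_append_drop (a * ρ p) w',
      hd, hd', ← ht, ← hcon, htake]
  rcases Sym2.eq_iff.1 h2 with ⟨hd, hd'⟩ | ⟨hd, hd'⟩
  · exact ⟨z, w, rfl, h1, hd, hd', aux z w rfl h1 hd hd'⟩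
  · exact ⟨w, z, Sym2.eq_swap, h1.symm, hd, hd', aux w z Sym2.eq_swap h1.symm hd hd'⟩

theorem mem_of_sym2_eq {V : Type*} {S : Finset V} {z w z' w' : V} (h : s(z', w') = s(z, w))
    (hz : z ∈ S) (hw : w ∈ S) : z' ∈ S ∧ w' ∈ S := by
  rcases Sym2.eq_iff.1 h with ⟨rfl, rfl⟩ | ⟨rfl, rfl⟩
  · exact ⟨hz, hw⟩
  · exact ⟨hw, hz⟩

/-- The bound of Conlon, Fox, Lee and Sudakov, in a form that passes to products: at most `p + 3`
strings span at least as many values as there are strings. -/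
theorem productExpanding_recColor {ρ : ℕ → ℕ} {p : ℕ} (hpos : ∀ d ≤ p, 0 < ρ d)
    {α : ℕ} {S : Finset (List Bool)} (hlen : ∀ x ∈ S, x.length = α) (hS : S.card ≤ p + 3) :
    ProductExpanding (recColor ρ p) S := by
  induction p generalizing α S with
  | zero =>
    induction α using Nat.strong_induction_on generalizing S with
    | _ α ih =>
    rcases Nat.eq_zero_or_pos α with rfl | hα
    · refine productExpanding_of_card_le_one _ (Finset.card_le_one.2 fun x hx y hy => ?_)
      rw [List.length_eq_zero_iff.1 (hlen x hx), List.length_eq_zero_iff.1 (hlen y hy)]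
    obtain ⟨a, ha, ha'⟩ := exists_length_split (hpos 0 le_rfl) hα
    have hle : ∀ x ∈ S, x.length ≤ a * ρ 0 + ρ 0 := fun x hx => (hlen x hx).trans_le ha'
    refine ProductExpanding.of_fibers (π := List.take (a * ρ 0)) (ih _ ha ?_ ?_) ?_ ?_
    · intro x' hx'
      obtain ⟨x, hx, rfl⟩ := Finset.mem_image.1 hx'
      rw [List.length_take, hlen x hx, min_eq_left ha.le]
    · exact Finset.card_image_le.trans hS
    · intro x hx y hy z hz w hw
      exact recColor_take (hpos 0 le_rfl) (hle x hx) (hle y hy) (hle z hz) (hle w hw)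
    · -- Two pairs as in `exists_of_recColor_eq` are disjoint, so `S` would have four elements.
      intro x hx y hy z hz w hw hne hxy heq
      by_contra hs
      obtain ⟨z', w', hs', ht, hd, hd', hxz⟩ := exists_of_recColor_eq (hpos 0 le_rfl) (hle x hx)
        (hle y hy) (hle z hz) (hle w hw) hne hxy heq hs
      obtain ⟨hz', hw'⟩ := mem_of_sym2_eq hs' hz hw
      have hzw : z' ≠ w' := by
        rintro rfl
        refine hne ?_
        rw [← List.take_append_drop (a * ρ 0) x, ← List.take_append_drop (a * ρ 0) y, hxy, hd, hd']
      have hcard : ({x, y, z', w'} : Finset (List Bool)).card = 4 := by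
        have h1 : x ≠ z' := fun h => hxz (h ▸ rfl)
        have h2 : x ≠ w' := fun h => hxz (by rw [ht, h])
        have h3 : y ≠ z' := fun h => hxz (by rw [hxy, h])
        have h4 : y ≠ w' := fun h => hxz (by rw [hxy, ht, h])
        simp [hne, h1, h2, h3, h4, hzw]
      have hsub : ({x, y, z', w'} : Finset (List Bool)) ⊆ S := by
        intro v hv
        simp only [Finset.mem_insert, Finset.mem_singleton] at hv
        rcases hv with rfl | rfl | rfl | rfl <;> assumption
      have := Finset.card_le_card hsub
      omega
  | succ p ihp =>
    induction α using Nat.strong_induction_on generalizing S with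
    | _ α ih =>
    rcases Nat.eq_zero_or_pos α with rfl | hα
    · refine productExpanding_of_card_le_one _ (Finset.card_le_one.2 fun x hx y hy => ?_)
      rw [List.length_eq_zero_iff.1 (hlen x hx), List.length_eq_zero_iff.1 (hlen y hy)]
    have hR : 0 < ρ (p + 1) := hpos _ le_rfl
    obtain ⟨a, ha, ha'⟩ := exists_length_split hR hα
    have hle : ∀ x ∈ S, x.length ≤ a * ρ (p + 1) + ρ (p + 1) :=
      fun x hx => (hlen x hx).trans_le ha'
    have hprefix : ProductExpanding (recColor ρ (p + 1)) (S.image (List.take (a * ρ (p + 1)))) := by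
      refine ih _ ha ?_ (Finset.card_image_le.trans hS)
      intro x' hx'
      obtain ⟨x, hx, rfl⟩ := Finset.mem_image.1 hx'
      rw [List.length_take, hlen x hx, min_eq_left ha.le]
    have htake : Refines (recColor ρ (p + 1)) (recColor ρ (p + 1)) (List.take (a * ρ (p + 1))) S :=
      fun x hx y hy z hz w hw => recColor_take hR (hle x hx) (hle y hy) (hle z hz) (hle w hw)
    by_cases hinj : Set.InjOn (List.drop (a * ρ (p + 1))) (S : Set (List Bool))
    · refine hprefix.of_fibers htake ?_
      intro x hx y hy z hz w hw hne hxy heq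
      by_contra hs
      obtain ⟨z', w', hs', -, hd, -, hxz⟩ := exists_of_recColor_eq hR (hle x hx)
        (hle y hy) (hle z hz) (hle w hw) hne hxy heq hs
      exact hxz (by rw [hinj hx (mem_of_sym2_eq hs' hz hw).1 hd])
    · have hcard : (S.image (List.drop (a * ρ (p + 1)))).card < S.card :=
        lt_of_le_of_ne Finset.card_image_le fun h => hinj (Finset.card_image_iff.1 h)
      have hsuffix : ProductExpanding (recColor ρ p) (S.image (List.drop (a * ρ (p + 1)))) := by
        refine ihp (fun d hd => hpos d (by omega)) (α := α - a * ρ (p + 1)) ?_ (by omega)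
        intro x' hx'
        obtain ⟨x, hx, rfl⟩ := Finset.mem_image.1 hx'
        rw [List.length_drop, hlen x hx]
      refine (hprefix.prod hsuffix).of_refines
        (j := fun x => (x.take (a * ρ (p + 1)), x.drop (a * ρ (p + 1)))) ?_ ?_ ?_
      · intro x hx
        exact Finset.mem_product.2 ⟨Finset.mem_image_of_mem _ hx, Finset.mem_image_of_mem _ hx⟩
      · intro x _ y _ hxy
        obtain ⟨h1, h2⟩ := Prod.mk.inj hxy
        rw [← List.take_append_drop (a * ρ (p + 1)) x, h1, h2, List.take_append_drop]
      · intro x hx y hy z hz w hw heq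
        exact Prod.ext (htake x hx y hy z hz w hw heq)
          (recColor_drop (hle x hx) (hle y hy) (hle z hz) (hle w hw) heq)

/-! ### Leftover structures -/

theorem mem_colorSet_of_mem {V C : Type*} {φ : V → V → C} {S : Finset V} {x y : V} (hx : x ∈ S)
    (hy : y ∈ S) (hne : x ≠ y) : φ x y ∈ colorSet φ S :=
  ⟨x, hx, y, hy, hne, rfl⟩

theorem colorSet_singleton {V C : Type*} (φ : V → V → C) (v : V) : colorSet φ {v} = ∅ := by
  ext c
  simp only [colorSet, Finset.mem_singleton, Set.mem_ofPred_eq, Set.mem_empty_iff_false, iff_false]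
  rintro ⟨x, rfl, y, rfl, hne, -⟩
  exact hne rfl

theorem colorSet_mono {V C : Type*} (φ : V → V → C) {S T : Finset V} (h : S ⊆ T) :
    colorSet φ S ⊆ colorSet φ T :=
  fun _ ⟨x, hx, y, hy, hne, hc⟩ => ⟨x, h hx, y, h hy, hne, hc⟩

/-- A leftover structure can be pulled back along a map under which the two colorings have the
same pairs of equally colored edges. -/
theorem HasLeftoverStructure.of_image {V W C D : Type*} [DecidableEq V] [DecidableEq W]
    {φ : V → V → C} {φ' : W → W → D} {π : V → W} {S : Finset V} (hinj : Set.InjOn π S)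
    (hiff : ∀ x ∈ S, ∀ y ∈ S, ∀ z ∈ S, ∀ w ∈ S,
      φ x y = φ z w ↔ φ' (π x) (π y) = φ' (π z) (π w))
    (h : HasLeftoverStructure φ' (S.image π)) : HasLeftoverStructure φ S := by
  generalize hT : S.image π = T at h
  induction h generalizing S with
  | single v =>
    obtain ⟨x, hx, rfl⟩ := Finset.mem_image.1 (hT ▸ Finset.mem_singleton_self v)
    have : S = {x} := by
      refine Finset.eq_singleton_iff_unique_mem.2 ⟨hx, fun y hy => hinj hy hx ?_⟩
      exact Finset.mem_singleton.1 (hT ▸ Finset.mem_image_of_mem π hy)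
    rw [this]
    exact .single x
  | bipartition A B γ hA hB hAB _ _ hcolors hcross hγA hγB ihA ihB =>
    have key : ∀ E : Finset W, E ⊆ A ∪ B → (S.filter (π · ∈ E)).image π = E := by
      intro E hE
      ext w
      simp only [Finset.mem_image, Finset.mem_filter]
      constructor
      · rintro ⟨x, ⟨-, hx⟩, rfl⟩
        exact hx
      · intro hw
        obtain ⟨x, hx, rfl⟩ := Finset.mem_image.1 (hT ▸ hE hw)
        exact ⟨x, ⟨hx, hw⟩, rfl⟩
    have keyA := key A Finset.subset_union_left
    have keyB := key B Finset.subset_union_right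
    have hsub : ∀ E : Finset W, S.filter (π · ∈ E) ⊆ S := fun E => Finset.filter_subset _ _
    have hcol : ∀ E : Finset W, ∀ x ∈ S.filter (π · ∈ E), ∀ y ∈ S.filter (π · ∈ E), x ≠ y →
        φ' (π x) (π y) ∈ colorSet φ' E := by
      intro E x hx y hy hne
      rw [Finset.mem_filter] at hx hy
      exact mem_colorSet_of_mem hx.2 hy.2 fun h => hne (hinj hx.1 hy.1 h)
    have hS : S = S.filter (π · ∈ A) ∪ S.filter (π · ∈ B) := by
      rw [← Finset.filter_or]
      refine (Finset.filter_true_of_mem fun x hx => ?_).symm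
      exact Finset.mem_union.1 (hT ▸ Finset.mem_image_of_mem π hx)
    have hneA : (S.filter (π · ∈ A)).Nonempty := by
      rw [← Finset.image_nonempty (f := π), keyA]; exact hA
    have hneB : (S.filter (π · ∈ B)).Nonempty := by
      rw [← Finset.image_nonempty (f := π), keyB]; exact hB
    obtain ⟨a, ha⟩ := id hneA
    obtain ⟨b, hb⟩ := id hneB
    have haS := hsub _ ha
    have hbS := hsub _ hb
    have hγ : φ' (π a) (π b) = γ :=
      hcross _ (Finset.mem_filter.1 ha).2 _ (Finset.mem_filter.1 hb).2
    rw [hS]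
    refine .bipartition _ _ (φ a b) hneA hneB ?_ ?_ ?_ ?_ ?_ ?_ ?_
    · rw [Finset.disjoint_left]
      intro x hx hx'
      exact Finset.disjoint_left.1 hAB (Finset.mem_filter.1 hx).2 (Finset.mem_filter.1 hx').2
    · exact ihA (hinj.mono (hsub A)) (fun x hx y hy z hz w hw =>
        hiff x (hsub _ hx) y (hsub _ hy) z (hsub _ hz) w (hsub _ hw)) keyA
    · exact ihB (hinj.mono (hsub B)) (fun x hx y hy z hz w hw =>
        hiff x (hsub _ hx) y (hsub _ hy) z (hsub _ hz) w (hsub _ hw)) keyB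
    · rw [Set.disjoint_left]
      rintro c ⟨x, hx, y, hy, hxy, rfl⟩ ⟨z, hz, w, hw, hzw, heq⟩
      refine Set.disjoint_left.1 hcolors (hcol A x hx y hy hxy) ?_
      rw [← (hiff z (hsub _ hz) w (hsub _ hw) x (hsub _ hx) y (hsub _ hy)).1 heq]
      exact hcol B z hz w hw hzw
    · intro x hx y hy
      refine (hiff x (hsub _ hx) y (hsub _ hy) a haS b hbS).2 ?_
      rw [hγ, hcross _ (Finset.mem_filter.1 hx).2 _ (Finset.mem_filter.1 hy).2]
    · rintro ⟨x, hx, y, hy, hxy, heq⟩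
      refine hγA ?_
      rw [← hγ, ← (hiff x (hsub _ hx) y (hsub _ hy) a haS b hbS).1 heq]
      exact hcol A x hx y hy hxy
    · rintro ⟨x, hx, y, hy, hxy, heq⟩
      refine hγB ?_
      rw [← hγ, ← (hiff x (hsub _ hx) y (hsub _ hy) a haS b hbS).1 heq]
      exact hcol B x hx y hy hxy

/-- Colors on `insert x₀ A`, where `x₀` is a twin of a vertex of `A`. -/
theorem colorSet_insert_twin {V C : Type*} [DecidableEq V] {φ : V → V → C}
    (hsymm : ∀ x y, φ x y = φ y x) {x₀ x₁ : V} {A : Finset V} (hx₁ : x₁ ∈ A)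
    (htwin : ∀ y ∈ A, y ≠ x₁ → φ x₀ y = φ x₁ y) :
    colorSet φ (insert x₀ A) ⊆ insert (φ x₀ x₁) (colorSet φ A) := by
  have aux : ∀ y ∈ A, φ x₀ y ∈ insert (φ x₀ x₁) (colorSet φ A) := by
    intro y hy
    by_cases hy₁ : y = x₁
    · exact Set.mem_insert_iff.2 (Or.inl (by rw [hy₁]))
    · rw [htwin y hy hy₁]
      exact Set.mem_insert_of_mem _ (mem_colorSet_of_mem hx₁ hy (Ne.symm hy₁))
  rintro c ⟨x, hx, y, hy, hne, rfl⟩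
  rcases Finset.mem_insert.1 hx with rfl | hx' <;> rcases Finset.mem_insert.1 hy with rfl | hy'
  · exact absurd rfl hne
  · exact aux y hy'
  · rw [hsymm x y]
    exact aux x hx'
  · exact Set.mem_insert_of_mem _ (mem_colorSet_of_mem hx' hy' hne)

/-- Adding a twin, joined to its original by a new color, preserves leftover structures. -/
theorem HasLeftoverStructure.insert_twin {V C : Type*} [DecidableEq V] {φ : V → V → C}
    (hsymm : ∀ x y, φ x y = φ y x) {x₀ x₁ : V} {S : Finset V} (h : HasLeftoverStructure φ S)
    (hx₁ : x₁ ∈ S) (hx₀ : x₀ ∉ S) (htwin : ∀ y ∈ S, y ≠ x₁ → φ x₀ y = φ x₁ y)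
    (hnew : φ x₀ x₁ ∉ colorSet φ S) : HasLeftoverStructure φ (insert x₀ S) := by
  induction h with
  | single v =>
    obtain rfl := Finset.mem_singleton.1 hx₁
    rw [Finset.insert_eq]
    refine .bipartition _ _ (φ x₀ x₁) (by simp) (by simp) ?_ (.single _) (.single _) ?_ ?_ ?_ ?_
    · simpa using fun h => hx₀ (Finset.mem_singleton.2 h)
    · simp [colorSet_singleton]
    · simp
    · simp [colorSet_singleton]
    · simp [colorSet_singleton]
  | bipartition A B γ hA hB hAB leftA leftB hcolors hcross hγA hγB ihA ihB =>
    -- The roles of `A` and `B` are symmetric.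
    have main : ∀ A B : Finset V, A.Nonempty → B.Nonempty → Disjoint A B →
        HasLeftoverStructure φ (insert x₀ A) → HasLeftoverStructure φ B →
        Disjoint (colorSet φ A) (colorSet φ B) → (∀ a ∈ A, ∀ b ∈ B, φ a b = γ) →
        γ ∉ colorSet φ A → γ ∉ colorSet φ B → x₁ ∈ A → x₀ ∉ A ∪ B →
        (∀ y ∈ A ∪ B, y ≠ x₁ → φ x₀ y = φ x₁ y) → φ x₀ x₁ ∉ colorSet φ (A ∪ B) →
        HasLeftoverStructure φ (insert x₀ (A ∪ B)) := by
      intro A B hA hB hAB leftA leftB hcolors hcross hγA hγB hx₁ hx₀ htwin hnew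
      have hx₁B : x₁ ∉ B := Finset.disjoint_left.1 hAB hx₁
      have hcolA := colorSet_insert_twin hsymm hx₁
        fun y hy hne => htwin y (Finset.mem_union_left B hy) hne
      have hγ : γ ∈ colorSet φ (A ∪ B) := by
        obtain ⟨b, hb⟩ := hB
        rw [← hcross x₁ hx₁ b hb]
        refine mem_colorSet_of_mem (Finset.mem_union_left _ hx₁) (Finset.mem_union_right _ hb) ?_
        rintro rfl
        exact hx₁B hb
      rw [← Finset.insert_union]
      refine .bipartition _ _ γ (Finset.insert_nonempty _ _) hB ?_ leftA leftB ?_ ?_ ?_ hγB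
      · rw [Finset.disjoint_insert_left]
        exact ⟨fun h => hx₀ (Finset.mem_union_right _ h), hAB⟩
      · refine Set.disjoint_of_subset_left hcolA ?_
        rw [Set.disjoint_insert_left]
        exact ⟨fun h => hnew (colorSet_mono φ Finset.subset_union_right h), hcolors⟩
      · intro x hx b hb
        rcases Finset.mem_insert.1 hx with rfl | hx
        · rw [htwin b (Finset.mem_union_right _ hb) (fun h => hx₁B (h ▸ hb))]
          exact hcross x₁ hx₁ b hb
        · exact hcross x hx b hb
      · intro h
        rcases hcolA h with h | h
        · exact hnew (h ▸ hγ)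
        · exact hγA h
    have restrict : ∀ E ⊆ A ∪ B, x₁ ∈ E →
        x₀ ∉ E ∧ (∀ y ∈ E, y ≠ x₁ → φ x₀ y = φ x₁ y) ∧ φ x₀ x₁ ∉ colorSet φ E :=
      fun E hE _ => ⟨fun h => hx₀ (hE h), fun y hy => htwin y (hE hy),
        fun h => hnew (colorSet_mono φ hE h)⟩
    rcases Finset.mem_union.1 hx₁ with hx | hx
    · obtain ⟨h1, h2, h3⟩ := restrict A Finset.subset_union_left hx
      exact main A B hA hB hAB (ihA hx h1 h2 h3) leftB hcolors hcross hγA hγB hx hx₀ htwin hnew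
    · obtain ⟨h1, h2, h3⟩ := restrict B Finset.subset_union_right hx
      rw [Finset.union_comm] at hx₀ htwin hnew ⊢
      exact main B A hB hA hAB.symm (ihB hx h1 h2 h3) leftA hcolors.symm
        (fun b hb a ha => by rw [hsymm]; exact hcross a ha b hb) hγB hγA hx hx₀ htwin hnew

/-! ### Sets with as few colors as possible -/

/-- Let the color of a pair inside a fiber of `π` determine that pair, let `φ` refine the
pullback of `φ'`, and let `S` have as few colors as possible. Then `φ` and `φ'` are equivalent
on pairs across fibers, the image of `S` has as few colors as possible, and a leftover structure
of the image lifts to `S`. The reason is that any `x₀` with a twin `x₁` in its fiber can be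
removed: only the color of `x₀` and `x₁` is lost, so that the rest again has as few colors as
possible and already shows all other colors. -/
theorem lift_of_tight {V W C D : Type*} [DecidableEq V] [DecidableEq W] {φ : V → V → C}
    {φ' : W → W → D} {π : V → W} {S : Finset V} (hsymm : ∀ x y, φ x y = φ y x)
    (hdiag : ∀ x y z, φ' x y = φ' z z → x = y)
    (hexp : Expanding φ S) (hexp' : Expanding φ' (S.image π)) (href : Refines φ φ' π S)
    (huniq : ∀ x ∈ S, ∀ y ∈ S, ∀ z ∈ S, ∀ w ∈ S, x ≠ y → π x = π y → φ x y = φ z w →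
      s(x, y) = s(z, w))
    (htight : (values φ S).card = S.card) :
    (∀ x ∈ S, ∀ y ∈ S, ∀ z ∈ S, ∀ w ∈ S, π x ≠ π y → φ' (π x) (π y) = φ' (π z) (π w) →
      φ x y = φ z w) ∧
    (values φ' (S.image π)).card = (S.image π).card ∧
    (HasLeftoverStructure φ' (S.image π) → HasLeftoverStructure φ S) := by
  classical
  induction hn : S.card using Nat.strong_induction_on generalizing S with
  | _ n ih =>
  subst hn
  by_cases hinj : Set.InjOn π S
  · have h1 : (S.image π).card = S.card := Finset.card_image_of_injOn hinj
    have h2 := hexp' _ Finset.Subset.rfl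
    have h3 := href.card_values_le
    have heq : ∀ x ∈ S, ∀ y ∈ S, ∀ z ∈ S, ∀ w ∈ S, φ' (π x) (π y) = φ' (π z) (π w) →
        φ x y = φ z w :=
      fun x hx y hy z hz w hw h => href.eq_of_card_le (by omega) hx hy hz hw h
    refine ⟨fun x hx y hy z hz w hw _ h => heq x hx y hy z hz w hw h, by omega, fun h => ?_⟩
    exact h.of_image hinj fun x hx y hy z hz w hw =>
      ⟨href x hx y hy z hz w hw, heq x hx y hy z hz w hw⟩
  · obtain ⟨x₀, hx₀, x₁, hx₁, hπ, hne⟩ :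
        ∃ x₀ ∈ S, ∃ x₁ ∈ S, π x₀ = π x₁ ∧ x₀ ≠ x₁ := by
      simpa [Set.InjOn] using hinj
    set S₀ := S.erase x₀ with hS₀
    have hsub : S₀ ⊆ S := S.erase_subset x₀
    have hx₁' : x₁ ∈ S₀ := Finset.mem_erase.2 ⟨hne.symm, hx₁⟩
    have hx₀' : x₀ ∉ S₀ := Finset.notMem_erase x₀ S
    have himg : S₀.image π = S.image π := by
      refine Finset.Subset.antisymm (Finset.image_subset_image hsub) ?_
      intro w hw
      obtain ⟨x, hx, rfl⟩ := Finset.mem_image.1 hw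
      by_cases hxx : x = x₀
      · exact Finset.mem_image.2 ⟨x₁, hx₁', by rw [hxx, hπ]⟩
      · exact Finset.mem_image_of_mem π (Finset.mem_erase.2 ⟨hxx, hx⟩)
    have hnew : φ x₀ x₁ ∉ values φ S₀ := by
      intro h
      obtain ⟨z, hz, w, hw, heq⟩ := mem_values.1 h
      have hs := huniq x₀ hx₀ x₁ hx₁ z (hsub hz) w (hsub hw) hne hπ heq.symm
      rcases Sym2.eq_iff.1 hs with ⟨rfl, -⟩ | ⟨rfl, -⟩
      · exact hx₀' hz
      · exact hx₀' hw
    have hins : insert (φ x₀ x₁) (values φ S₀) ⊆ values φ S := by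
      intro c hc
      rcases Finset.mem_insert.1 hc with rfl | hc
      · exact mem_values_of_mem hx₀ hx₁
      · exact values_mono hsub hc
    have hc₀ : S₀.card + 1 = S.card := Finset.card_erase_add_one hx₀
    have h1 := Finset.card_le_card hins
    rw [Finset.card_insert_of_notMem hnew] at h1
    have h2 := hexp S₀ hsub
    have hvalues : insert (φ x₀ x₁) (values φ S₀) = values φ S := by
      refine Finset.eq_of_subset_of_card_le hins ?_
      rw [Finset.card_insert_of_notMem hnew]
      omega
    obtain ⟨ih1, ih2, ih3⟩ := ih S₀.card (by omega) (S := S₀) (fun T hT => hexp T (hT.trans hsub))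
      (by rwa [himg]) (href.mono hsub)
      (fun x hx y hy z hz w hw => huniq x (hsub hx) y (hsub hy) z (hsub hz) w (hsub hw))
      (by omega) rfl
    -- Every pair across fibers has its color already in `S₀`, on a pair across fibers.
    have hrep : ∀ x ∈ S, ∀ y ∈ S, π x ≠ π y → ∃ u ∈ S₀, ∃ v ∈ S₀, π u ≠ π v ∧ φ u v = φ x y := by
      intro x hx y hy hxy
      have hmem : φ x y ∈ insert (φ x₀ x₁) (values φ S₀) := hvalues ▸ mem_values_of_mem hx hy
      rcases Finset.mem_insert.1 hmem with h | h
      · have := href x hx y hy x₀ hx₀ x₁ hx₁ h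
        rw [hπ] at this
        exact absurd (hdiag _ _ _ this) hxy
      · obtain ⟨u, hu, v, hv, huv⟩ := mem_values.1 h
        refine ⟨u, hu, v, hv, fun hcon => hxy ?_, huv⟩
        have := href u (hsub hu) v (hsub hv) x hx y hy huv
        rw [hcon] at this
        exact hdiag _ _ _ this.symm
    have hcross : ∀ x ∈ S, ∀ y ∈ S, ∀ z ∈ S, ∀ w ∈ S, π x ≠ π y →
        φ' (π x) (π y) = φ' (π z) (π w) → φ x y = φ z w := by
      intro x hx y hy z hz w hw hxy heq
      have hzw : π z ≠ π w := by
        intro hcon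
        rw [hcon] at heq
        exact hxy (hdiag _ _ _ heq)
      obtain ⟨u, hu, v, hv, huv, huv'⟩ := hrep x hx y hy hxy
      obtain ⟨s, hs, t, ht, -, hst'⟩ := hrep z hz w hw hzw
      rw [← huv', ← hst']
      refine ih1 u hu v hv s hs t ht huv ?_
      rw [href u (hsub hu) v (hsub hv) x hx y hy huv', heq,
        href s (hsub hs) t (hsub ht) z hz w hw hst']
    refine ⟨hcross, by rw [← himg]; exact ih2, fun h => ?_⟩
    rw [← himg] at h
    have hS : insert x₀ S₀ = S := Finset.insert_erase hx₀
    rw [← hS]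
    refine (ih3 h).insert_twin hsymm hx₁' hx₀' ?_ ?_
    · intro y hy hyx
      have hyS := hsub hy
      have hyx₀ : y ≠ x₀ := fun hcon => hx₀' (hcon ▸ hy)
      by_cases hπy : π x₀ = π y
      · -- A third element of the fiber would give a color on `S` that is not in `hvalues`.
        exfalso
        have hmem : φ x₀ y ∈ insert (φ x₀ x₁) (values φ S₀) := hvalues ▸ mem_values_of_mem hx₀ hyS
        rcases Finset.mem_insert.1 hmem with h | h
        · have hs := huniq x₀ hx₀ y hyS x₀ hx₀ x₁ hx₁ hyx₀.symm hπy h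
          rcases Sym2.eq_iff.1 hs with ⟨-, h'⟩ | ⟨-, h'⟩
          · exact hyx h'
          · exact hyx₀ h'
        · obtain ⟨u, hu, v, hv, huv⟩ := mem_values.1 h
          have hs := huniq x₀ hx₀ y hyS u (hsub hu) v (hsub hv) hyx₀.symm hπy huv.symm
          rcases Sym2.eq_iff.1 hs with ⟨rfl, -⟩ | ⟨rfl, -⟩
          · exact hx₀' hu
          · exact hx₀' hv
      · exact hcross x₀ hx₀ y hyS x₁ hx₁ y hyS hπy (by rw [hπ])
    · rintro ⟨z, hz, w, hw, -, hzw⟩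
      exact hnew (hzw ▸ mem_values_of_mem hz hw)

/-- A set of at most `p + 4` strings with as few colors under `c_{p+1}` as possible. -/
theorem leftover_or_striped_recColor {ρ : ℕ → ℕ} {p : ℕ}
    (hpos : ∀ d ≤ p + 1, 0 < ρ d) {α : ℕ} {S : Finset (List Bool)}
    (hlen : ∀ x ∈ S, x.length = α) (hne : S.Nonempty) (hS : S.card ≤ p + 1 + 3)
    (htight : (values (recColor ρ (p + 1)) S).card = S.card) :
    HasLeftoverStructure (recColor ρ (p + 1)) S ∨
      ContainsStripedK4 (recColor ρ (p + 1)) S := by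
  induction α using Nat.strong_induction_on generalizing S with
  | _ α ih =>
  rcases Nat.eq_zero_or_pos α with rfl | hα
  · obtain ⟨v, hv⟩ := hne
    have : S = {v} := Finset.eq_singleton_iff_unique_mem.2 ⟨hv, fun x hx => by
      rw [List.length_eq_zero_iff.1 (hlen x hx), List.length_eq_zero_iff.1 (hlen v hv)]⟩
    rw [this]
    exact Or.inl (.single v)
  have hR : 0 < ρ (p + 1) := hpos _ le_rfl
  obtain ⟨a, ha, ha'⟩ := exists_length_split hR hα
  set π : List Bool → List Bool := List.take (a * ρ (p + 1)) with hπ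
  have hle : ∀ x ∈ S, x.length ≤ a * ρ (p + 1) + ρ (p + 1) := fun x hx => (hlen x hx).trans_le ha'
  have href : Refines (recColor ρ (p + 1)) (recColor ρ (p + 1)) π S :=
    fun x hx y hy z hz w hw => recColor_take hR (hle x hx) (hle y hy) (hle z hz) (hle w hw)
  have hlen' : ∀ x ∈ S.image π, x.length = a * ρ (p + 1) := by
    intro x' hx'
    obtain ⟨x, hx, rfl⟩ := Finset.mem_image.1 hx'
    rw [hπ, List.length_take, hlen x hx, min_eq_left ha.le]
  have hS' : (S.image π).card ≤ p + 1 + 3 := Finset.card_image_le.trans hS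
  by_cases hstr : ContainsStripedK4 (recColor ρ (p + 1)) S
  · exact Or.inr hstr
  have huniq : ∀ x ∈ S, ∀ y ∈ S, ∀ z ∈ S, ∀ w ∈ S, x ≠ y → π x = π y →
      recColor ρ (p + 1) x y = recColor ρ (p + 1) z w → s(x, y) = s(z, w) := by
    -- Two pairs as in `exists_of_recColor_eq` form a striped `K_4`.
    intro x hx y hy z hz w hw hxy hπxy heq
    by_contra hs
    obtain ⟨z', w', hs', ht, hd, hd', hxz⟩ := exists_of_recColor_eq hR (hle x hx)
        (hle y hy) (hle z hz) (hle w hw) hxy hπxy heq hs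
    obtain ⟨hz', hw'⟩ := mem_of_sym2_eq hs' hz hw
    have hπxy' : x.take (a * ρ (p + 1)) = y.take (a * ρ (p + 1)) := hπxy
    have hdne : x.drop (a * ρ (p + 1)) ≠ y.drop (a * ρ (p + 1)) := by
      intro hcon
      refine hxy ?_
      rw [← List.take_append_drop (a * ρ (p + 1)) x, ← List.take_append_drop (a * ρ (p + 1)) y,
        hπxy', hcon]
    have h1 : recColor ρ (p + 1) x y = recColor ρ (p + 1) z' w' := by
      rcases Sym2.eq_iff.1 hs' with ⟨rfl, rfl⟩ | ⟨rfl, rfl⟩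
      · exact heq
      · rw [heq, recColor_comm]
    have h2 : recColor ρ (p + 1) x z' = recColor ρ (p + 1) y w' := by
      refine recColor_eq_of_take_of_drop hR (hle x hx) (hle z' hz') (hle y hy) (hle w' hw') hxz ?_ ?_
      · rw [hπxy', ht]
      · rw [hd, hd', recColor_self]
    have h3 : recColor ρ (p + 1) x w' = recColor ρ (p + 1) y z' := by
      refine recColor_eq_of_take_of_drop hR (hle x hx) (hle w' hw') (hle y hy) (hle z' hz')
        (by rwa [← ht]) ?_ ?_
      · rw [hπxy', ht]
      · rw [← hd, ← hd', recColor_comm]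
    have h4 : ∀ u ∈ S, u.take (a * ρ (p + 1)) = z'.take (a * ρ (p + 1)) →
        recColor ρ (p + 1) x y ≠ recColor ρ (p + 1) x u := by
      intro u hu hu' hcon
      have := href x hx y hy x hx u hu hcon
      rw [hπxy] at this
      exact hxz (by rw [← hu', hπxy']; exact recColor_eq_self.1 this.symm)
    have h5 : recColor ρ (p + 1) x z' ≠ recColor ρ (p + 1) x w' := by
      intro hcon
      have := recColor_drop (hle x hx) (hle z' hz') (hle x hx) (hle w' hw') hcon
      rw [hd, ← hd', ← hd] at this
      exact hdne (recColor_eq_self.1 this.symm)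
    refine hstr ⟨x, hx, y, hy, z', hz', w', hw', ⟨hxy, ?_, ?_, ?_, ?_, ?_⟩, ⟨h1, h2, h3⟩,
      h4 z' hz' rfl, h4 w' hw' ht.symm, h5⟩
    · exact fun h => hxz (h ▸ rfl)
    · exact fun h => hxz (by rw [ht, h])
    · exact fun h => hxz (by rw [hπxy', h])
    · exact fun h => hxz (by rw [hπxy', ht, h])
    · intro h
      exact hdne (by rw [hd, hd', h])
  obtain ⟨h1, h2, h3⟩ := lift_of_tight (recColor_comm ρ (p + 1))
    (fun x y z => recColor_eq_self.1) (productExpanding_recColor hpos hlen hS).expanding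
    (productExpanding_recColor hpos hlen' hS').expanding href huniq htight
  rcases ih _ ha hlen' (hne.image π) hS' h2 with h | ⟨a', ha', b', hb', c', hc', d', hd', hK⟩
  · exact Or.inl (h3 h)
  · obtain ⟨x, hx, rfl⟩ := Finset.mem_image.1 ha'
    obtain ⟨y, hy, rfl⟩ := Finset.mem_image.1 hb'
    obtain ⟨z, hz, rfl⟩ := Finset.mem_image.1 hc'
    obtain ⟨w, hw, rfl⟩ := Finset.mem_image.1 hd'
    obtain ⟨⟨n1, n2, n3, n4, n5, n6⟩, ⟨e1, e2, e3⟩, d1, d2, d3⟩ := hK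
    refine absurd ⟨x, hx, y, hy, z, hz, w, hw, ⟨?_, ?_, ?_, ?_, ?_, ?_⟩,
      ⟨h1 x hx y hy z hz w hw n1 e1, h1 x hx z hz y hy w hw n2 e2, h1 x hx w hw y hy z hz n3 e3⟩,
      fun h => d1 (href x hx y hy x hx z hz h), fun h => d2 (href x hx y hy x hx w hw h),
      fun h => d3 (href x hx z hz x hx w hw h)⟩ hstr
    · exact fun h => n1 (h ▸ rfl)
    · exact fun h => n2 (h ▸ rfl)
    · exact fun h => n3 (h ▸ rfl)
    · exact fun h => n4 (h ▸ rfl)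
    · exact fun h => n5 (h ▸ rfl)
    · exact fun h => n6 (h ▸ rfl)

/-! ### From lists to strings of fixed length -/

theorem lt_numBlocks_of_lt {r α i : ℕ} (hr : 0 < r) (h : i * r < α) : i < numBlocks r α := by
  rw [numBlocks, Nat.lt_succ_iff, Nat.le_div_iff_mul_le hr]
  omega

/-- `ξ_d` records the values of `η_d` at all blocks; blocks beyond the end are empty. -/
theorem xi_eq_iff {p : ℕ} {r : ℕ → ℕ} {α : ℕ} {d : ℕ} (hr : 0 < param p r α (d + 1))
    {x y z w : BinString α} :
    xi p r d x y = xi p r d z w ↔ ∀ i,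
      eta (param p r α d) (block (param p r α (d + 1)) i x.toList)
        (block (param p r α (d + 1)) i y.toList) =
      eta (param p r α d) (block (param p r α (d + 1)) i z.toList)
        (block (param p r α (d + 1)) i w.toList) := by
  rw [xi, xi, List.map_inj_left]
  refine ⟨fun h i => ?_, fun h i _ => h i⟩
  by_cases hi : i * param p r α (d + 1) < α
  · exact h i (List.mem_range.2 (lt_numBlocks_of_lt hr hi))
  · have hnil : ∀ v : BinString α, block (param p r α (d + 1)) i v.toList = [] := fun v =>
      block_eq_nil (by rw [List.Vector.toList_length]; omega)
    simp [hnil]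

/-- The block lengths `r_0 = 1, r_1, …, r_p`. -/
def blockLength (r : ℕ → ℕ) (d : ℕ) : ℕ :=
  if d = 0 then 1 else r d

theorem blockLength_pos {p : ℕ} {r : ℕ → ℕ} (hpos : ∀ d, 1 ≤ d → d ≤ p → 1 ≤ r d) {d : ℕ}
    (hd : d ≤ p) : 0 < blockLength r d := by
  unfold blockLength
  split_ifs with h0
  · exact Nat.one_pos
  · exact hpos d (Nat.one_le_iff_ne_zero.2 h0) hd

theorem cflsColor_eq_iff {p : ℕ} {r : ℕ → ℕ} (hpos : ∀ d, 1 ≤ d → d ≤ p → 1 ≤ r d)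
    (hdvd : ∀ d, 1 ≤ d → d < p → r d ∣ r (d + 1)) {α : ℕ} (hα : 1 ≤ α) {x y z w : BinString α} :
    cflsColor p r x y = cflsColor p r z w ↔
      recColor (blockLength r) p x.toList y.toList =
        recColor (blockLength r) p z.toList w.toList := by
  set ρ : ℕ → ℕ := blockLength r with hρ
  have hρpos : ∀ d ≤ p, 0 < ρ d := fun d hd => blockLength_pos hpos hd
  have hρdvd : ∀ d < p, ρ d ∣ ρ (d + 1) := by
    intro d hd
    by_cases h0 : d = 0
    · simp [hρ, blockLength, h0]
    · simpa [hρ, blockLength, h0] using hdvd d (by omega) hd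
  have hparam : ∀ d ≤ p, param p r α d = ρ d := by
    intro d hd
    simp [param, hρ, blockLength, hd]
  have htop : param p r α (p + 1) = α := by
    simp [param]
  rw [recColor_eq_iff hρpos hρdvd, funext_iff]
  have hblock : ∀ v : BinString α, block α 0 v.toList = v.toList := fun v => by
    rw [block, Nat.zero_mul, List.drop_zero, List.take_of_length_le]
    rw [List.Vector.toList_length]
  have hblock' : ∀ i, i ≠ 0 → ∀ v : BinString α, block α i v.toList = [] := fun i hi v =>
    block_eq_nil (by rw [List.Vector.toList_length]; exact Nat.le_mul_of_pos_left α (by omega))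
  constructor
  · intro h
    refine ⟨?_, fun d hd i => ?_⟩
    · have := (xi_eq_iff (d := p) (by rw [htop]; omega)).1 (h ⟨p, by omega⟩) 0
      rwa [htop, hparam p le_rfl, hblock, hblock, hblock, hblock] at this
    · have := (xi_eq_iff (d := d) (by rw [hparam _ hd]; exact hρpos _ hd)).1 (h ⟨d, by omega⟩) i
      rwa [hparam d hd.le, hparam (d + 1) hd] at this
  · rintro ⟨h1, h2⟩ ⟨d, hd⟩
    rcases Nat.lt_succ_iff_lt_or_eq.1 hd with hd | rfl
    · refine (xi_eq_iff (by rw [hparam _ hd]; exact hρpos _ hd)).2 fun i => ?_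
      rw [hparam d hd.le, hparam (d + 1) hd]
      exact h2 d hd i
    · refine (xi_eq_iff (by rw [htop]; omega)).2 fun i => ?_
      rw [htop, hparam d le_rfl]
      by_cases hi : i = 0
      · rwa [hi, hblock, hblock, hblock, hblock]
      · simp only [hblock' i hi, eta_self]

/-- The diagonal contributes one value besides the colors. -/
theorem card_values {V C : Type*} {φ : V → V → C} {S : Finset V} (hS : S.Nonempty)
    (hdiag : ∀ x y z, φ x y = φ z z ↔ x = y) :
    (values φ S).card = (colorSet φ S).ncard + 1 := by
  classical
  obtain ⟨v, hv⟩ := hS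
  have hcoe : (values φ S : Set C) = insert (φ v v) (colorSet φ S) := by
    ext c
    simp only [Finset.mem_coe, mem_values, Set.mem_insert_iff]
    constructor
    · rintro ⟨x, hx, y, hy, rfl⟩
      by_cases hxy : x = y
      · exact Or.inl ((hdiag x y v).2 hxy)
      · exact Or.inr (mem_colorSet_of_mem hx hy hxy)
    · rintro (rfl | ⟨x, hx, y, hy, -, rfl⟩)
      · exact ⟨v, hv, v, hv, rfl⟩
      · exact ⟨x, hx, y, hy, rfl⟩
  have hfin : (colorSet φ S).Finite :=
    (values φ S).finite_toSet.subset (hcoe ▸ Set.subset_insert _ _)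
  rw [← Set.ncard_coe_finset, hcoe, Set.ncard_insert_of_notMem _ hfin]
  rintro ⟨x, -, y, -, hne, h⟩
  exact hne ((hdiag x y v).1 h)

end CFLS

theorem lemma2p1 (p : ℕ) (hp : 1 ≤ p) (r : ℕ → ℕ)
    (hpos : ∀ d, 1 ≤ d → d ≤ p → 1 ≤ r d)
    (hmono : ∀ d, 1 ≤ d → d < p → r d ≤ r (d + 1))
    (hdvd : ∀ d, 1 ≤ d → d < p → r d ∣ r (d + 1))
    (α : ℕ) (hα : 1 ≤ α)
    (S : Finset (CFLS.BinString α)) (hS : S.card ≤ p + 3)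
    (hcolors : (CFLS.colorSet (CFLS.cflsColor p r) S).ncard + 1 = S.card) :
    CFLS.HasLeftoverStructure (CFLS.cflsColor p r) S ∨
      CFLS.ContainsStripedK4 (CFLS.cflsColor p r) S := by
  open CFLS in
  set ρ : ℕ → ℕ := blockLength r with hρ
  have hiff : ∀ x y z w : BinString α, cflsColor p r x y = cflsColor p r z w ↔
      recColor ρ p x.toList y.toList = recColor ρ p z.toList w.toList :=
    fun x y z w => cflsColor_eq_iff hpos hdvd hα
  have hinj : Function.Injective (List.Vector.toList : BinString α → List Bool) :=
    List.Vector.toList_injective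
  have hne : S.Nonempty := Finset.card_pos.1 (by omega)
  have hdiag : ∀ x y z : BinString α, cflsColor p r x y = cflsColor p r z z ↔ x = y := by
    intro x y z
    rw [hiff, recColor_eq_self]
    exact hinj.eq_iff
  have hvalues : (values (cflsColor p r) S).card = S.card := by
    rw [card_values hne hdiag, hcolors]
  obtain ⟨q, rfl⟩ : ∃ q, p = q + 1 := ⟨p - 1, by omega⟩
  have hρpos : ∀ d ≤ q + 1, 0 < ρ d := fun d hd => blockLength_pos hpos hd
  have hlen : ∀ x ∈ S.image List.Vector.toList, x.length = α := by
    intro x hx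
    obtain ⟨v, -, rfl⟩ := Finset.mem_image.1 hx
    exact v.toList_length
  have hcard : (S.image List.Vector.toList).card = S.card := Finset.card_image_of_injective S hinj
  have href : Refines (cflsColor (q + 1) r) (recColor ρ (q + 1)) List.Vector.toList S :=
    fun x _ y _ z _ w _ => (hiff x y z w).1
  have htight : (values (recColor ρ (q + 1)) (S.image List.Vector.toList)).card =
      (S.image List.Vector.toList).card := by
    have h1 := href.card_values_le
    have h2 := (productExpanding_recColor hρpos hlen
      (hcard.trans_le hS)).expanding _ Finset.Subset.rfl
    omega
  rcases leftover_or_striped_recColor hρpos hlen (hne.image _)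
    (hcard.trans_le hS) htight with h | ⟨a, ha, b, hb, c, hc, d, hd, hK⟩
  · exact Or.inl (h.of_image hinj.injOn fun x _ y _ z _ w _ => hiff x y z w)
  · obtain ⟨x, hx, rfl⟩ := Finset.mem_image.1 ha
    obtain ⟨y, hy, rfl⟩ := Finset.mem_image.1 hb
    obtain ⟨z, hz, rfl⟩ := Finset.mem_image.1 hc
    obtain ⟨w, hw, rfl⟩ := Finset.mem_image.1 hd
    refine Or.inr ⟨x, hx, y, hy, z, hz, w, hw, ?_⟩
    simpa [IsStripedK4, hiff, hinj.eq_iff] using hK
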